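/- Let $\mathbb{F}$ be an algebraically closed field of characteristic zero and let $\mathfrak{L}$ be a (left) Leibniz algebra over $\mathbb{F}$, i.e. an $\mathbb{F}$-vector space with a bilinear product satisfying $x(yz)=(xy)z+y(xz)$. Let $\mathrm{Leib}(\mathfrak{L})$ be the span of all squares $x^2$ and $\mathfrak{L}_{\mathrm{Lie}}=\mathfrak{L}/\mathrm{Leib}(\mathfrak{L})$ the canonical Lie algebra of $\mathfrak{L}$. Assume that $\mathfrak{L}$ is solvable (the derived series $\mathfrak{L}^{(0)}=\mathfrak{L}$, $\mathfrak{L}^{(n+1)}=\mathfrak{L}^{(n)}\mathfrak{L}^{(n)}$ reaches $0$) and that $\mathfrak{L}_{\mathrm{Lie}}$ is finite-dimensional, and put $k=\dim_{\mathbb{F}}\mathfrak{L}_{\mathrm{Lie}}/[\mathfrak{L}_{\mathrm{Lie}},\mathfrak{L}_{\mathrm{Lie}}]$. Then $$\mathrm{Gr}^{\mathrm{bi}}(\mathfrak{L})\;\cong\;\mathbb{Z}[(\mathbb{F}^+)^k]\circledast\mathbb{Z}[(\mathbb{F}^+)^k]$$ as unital commutative (not necessarily associative) rings, where $\mathbb{F}^+$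 is the additive group of $\mathbb{F}$, $\mathbb{Z}[G]$ is the integral group ring of $G$, and the other notation is as follows. An $\mathfrak{L}$-bimodule is an $\mathbb{F}$-vector space $M$ with bilinear left and right actions of $\mathfrak{L}$ such that $(xy)\cdot m=x\cdot(y\cdot m)-y\cdot(x\cdot m)$, $(x\cdot m)\cdot y=x\cdot(m\cdot y)-m\cdot(xy)$ and $(m\cdot x)\cdot y=m\cdot(xy)-x\cdot(m\cdot y)$. For bimodules $M,N$ let $\mathfrak{L}$ act on $M\otimes N$ by $x\cdot(m\otimes n)=(x\cdot m)\otimes n+m\otimes(x\cdot n)$ and $(m\otimes n)\cdot x=(m\cdot x)\otimes n+m\otimes(n\cdot x)$, and let $M\overline{\otimes}N=(M\otimes N)/T(M,N)$, where $T(M,N)$ is the smallest subspace that is stable under both actions and contains all $(x\cdot m+m\cdot x)\otimes(n\cdot y)+(m\cdot y)\otimes(x\cdot n+n\cdot x)$; this is again a bimodule. $\mathrm{Gr}^{\mathrm{bi}}(\mathfrak{L})$ is the free abelian group on the isomorphism classes $[S]$ of finite-dimensional irreducible $\mathfrak{L}$-bimodules, with the biadditive multiplication given on irreducible bimodules by $[M]\cdot[N]=\sum_{[S]}[M\overline{\otimes}N:S]\,[S]$,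 where $[X:S]$ is the multiplicity of $S$ in a composition series of $X$. Its unity is the class of the one-dimensional trivial bimodule. For unital commutative (not necessarily associative) rings $A,B$ whose additive groups are free with bases $A_1\ni 1_A$, $B_1\ni 1_B$, the ring $A\circledast B$ is the free abelian group on the disjoint union of $\{1\}$, $\widetilde{A}=A_1\setminus\{1_A\}$ and $\widetilde{B}=B_1\setminus\{1_B\}$, with the biadditive multiplication for which $1$ is the unity, products of two elements of $\widetilde{A}$ (respectively of $\widetilde{B}$) are taken in $A$ (respectively $B$) with $1_A$ (respectively $1_B$) replaced by $1$, and $ab=ba=0$ for $a\in\widetilde{A}$, $b\in\widetilde{B}$. For a group ring the basis of group elements is used. -/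

import Mathlib

open scoped TensorProduct

universe u v

/-! ### Left Leibniz algebras

An `F`-algebra without any further identity is a `NonUnitalNonAssocRing` with an `F`-module structure
for which the multiplication is `F`-bilinear (`IsScalarTower F L L` and `SMulCommClass F L L`). -/

/-- The left Leibniz identity: all left multiplications are derivations. -/
class IsLeftLeibniz (L : Type v) [NonUnitalNonAssocRing L] : Prop where
  leibniz : ∀ x y z : L, x * (y * z) = (x * y) * z + y * (x * z)

namespace LeibnizAlg

section Algebra

variable (F : Type u) (L : Type v) [Field F] [NonUnitalNonAssocRing L] [Module F L]

/-- The derived series `L⁽⁰⁾ = L`, `L⁽ⁿ⁺¹⁾ = L⁽ⁿ⁾ L⁽ⁿ⁾` (linear span of all products). -/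
def derivedSeries : ℕ → Submodule F L
  | 0 => ⊤
  | n + 1 => Submodule.span F {z | ∃ x ∈ derivedSeries n, ∃ y ∈ derivedSeries n, z = x * y}

/-- `L` is solvable if its derived series reaches `0`. -/
def IsSolvable : Prop := ∃ n : ℕ, derivedSeries F L n = ⊥

/-- The Leibniz kernel: the linear span of all squares. -/
def leibKer : Submodule F L := Submodule.span F (Set.range fun x : L => x * x)

theorem sq_mem_leibKer (x : L) : x * x ∈ leibKer F L := Submodule.subset_span ⟨x, rfl⟩

/-- The canonical Lie algebra `L_Lie = L / Leib(L)`; its bracket is induced by the product of `L`. -/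
def LLie : Type v := L ⧸ leibKer F L

instance : AddCommGroup (LLie F L) := inferInstanceAs (AddCommGroup (L ⧸ leibKer F L))
instance : Module F (LLie F L) := inferInstanceAs (Module F (L ⧸ leibKer F L))

/-- The canonical projection `L → L_Lie`. -/
def toLLie : L →ₗ[F] LLie F L := (leibKer F L).mkQ

theorem toLLie_surjective : Function.Surjective (toLLie F L) := Submodule.mkQ_surjective _

theorem toLLie_eq_zero_iff {x : L} : toLLie F L x = 0 ↔ x ∈ leibKer F L :=
  Submodule.Quotient.mk_eq_zero _

variable [IsScalarTower F L L] [SMulCommClass F L L] [IsLeftLeibniz L]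

theorem mul_mem_leibKer_left (x : L) {z : L} (hz : z ∈ leibKer F L) : x * z ∈ leibKer F L := by
  have h : leibKer F L ≤ (leibKer F L).comap (LinearMap.mul F L x) := by
    refine Submodule.span_le.2 ?_
    rintro _ ⟨y, rfl⟩
    have e : x * (y * y) = (x * y + y) * (x * y + y) - (x * y) * (x * y) - y * y := by
      rw [IsLeftLeibniz.leibniz x y y]
      simp only [mul_add, add_mul]
      abel
    simp only [Submodule.comap_coe, Set.mem_preimage, LinearMap.mul_apply', SetLike.mem_coe, e]
    exact sub_mem (sub_mem (sq_mem_leibKer F L _) (sq_mem_leibKer F L _)) (sq_mem_leibKer F L _)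
  exact h hz

theorem mul_eq_zero_of_mem_leibKer {z : L} (hz : z ∈ leibKer F L) (x : L) : z * x = 0 := by
  have h : leibKer F L ≤ LinearMap.ker ((LinearMap.mul F L).flip x) := by
    refine Submodule.span_le.2 ?_
    rintro _ ⟨y, rfl⟩
    have := IsLeftLeibniz.leibniz y y x
    simpa using this
  exact h hz

/-- The bilinear product induced on `L / Leib(L)`. -/
def lieMul : LLie F L →ₗ[F] LLie F L →ₗ[F] LLie F L :=
  (leibKer F L).liftQ
    (LinearMap.mk₂ F
      (fun (x : L) (y : LLie F L) =>
        (leibKer F L).mapQ (leibKer F L) (LinearMap.mul F L x)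
          (fun _ hz => mul_mem_leibKer_left F L x hz) y)
      (by
        intro x x' y
        obtain ⟨y, rfl⟩ := toLLie_surjective F L y
        change toLLie F L ((x + x') * y) = toLLie F L (x * y) + toLLie F L (x' * y)
        rw [add_mul, map_add])
      (by
        intro c x y
        obtain ⟨y, rfl⟩ := toLLie_surjective F L y
        change toLLie F L ((c • x) * y) = c • toLLie F L (x * y)
        rw [smul_mul_assoc, map_smul])
      (by intro x y y'; exact map_add _ y y')
      (by intro c x y; exact map_smul _ c y))
    (by
      intro x hx
      rw [LinearMap.mem_ker]
      ext y
      obtain ⟨y, rfl⟩ := toLLie_surjective F L y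
      change toLLie F L (x * y) = 0
      rw [mul_eq_zero_of_mem_leibKer F L hx, map_zero])

instance : Bracket (LLie F L) (LLie F L) := ⟨fun a b => lieMul F L a b⟩

theorem toLLie_mul (x y : L) : toLLie F L (x * y) = ⁅toLLie F L x, toLLie F L y⁆ := rfl

instance : LieRing (LLie F L) where
  add_lie x y z := by change lieMul F L (x + y) z = _; rw [map_add]; rfl
  lie_add x y z := map_add (lieMul F L x) y z
  lie_self x := by
    obtain ⟨x, rfl⟩ := toLLie_surjective F L x
    rw [← toLLie_mul, toLLie_eq_zero_iff]
    exact sq_mem_leibKer F L x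
  leibniz_lie x y z := by
    obtain ⟨x, rfl⟩ := toLLie_surjective F L x
    obtain ⟨y, rfl⟩ := toLLie_surjective F L y
    obtain ⟨z, rfl⟩ := toLLie_surjective F L z
    simp only [← toLLie_mul, ← map_add]
    rw [IsLeftLeibniz.leibniz x y z]

instance : LieAlgebra F (LLie F L) where
  lie_smul c x y := map_smul (lieMul F L x) c y

/-- `dim L_Lie / [L_Lie, L_Lie]`. -/
noncomputable def abelianRank : ℕ :=
  Module.finrank F (LLie F L ⧸ ⁅(⊤ : LieIdeal F (LLie F L)), (⊤ : LieIdeal F (LLie F L))⁆)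

end Algebra

/-! ### Finite-dimensional bimodules -/

section Actions

variable {F : Type u} {L : Type v} [Field F] [AddCommGroup L] [Module F L]
variable {V : Type*} [AddCommGroup V] [Module F V]

/-- Restriction of a linear family of endomorphisms to an invariant subspace. -/
def subAct (a : L →ₗ[F] Module.End F V) (p : Submodule F V) (h : ∀ x, ∀ m ∈ p, a x m ∈ p) :
    L →ₗ[F] Module.End F p where
  toFun x := (a x).restrict (h x)
  map_add' x y := by ext m; simp
  map_smul' c x := by ext m; simp

/-- The family induced by a linear family of endomorphisms on the quotient by an invariant
subspace. -/
def quotAct (a : L →ₗ[F] Module.End F V) (p : Submodule F V) (h : ∀ x, ∀ m ∈ p, a x m ∈ p) :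
    L →ₗ[F] Module.End F (V ⧸ p) where
  toFun x := p.mapQ p (a x) (h x)
  map_add' x y := by ext m; simp
  map_smul' c x := by ext m; simp

end Actions

/-- A finite-dimensional bimodule over the left Leibniz algebra `L`. The left action is
`x · m = left x m`, the right action is `m · x = right x m`. As a finite-dimensional `F`-vector space
has an isomorphic copy in the universe of `F`, this universe loses no isomorphism class. -/
structure FDBimod (F : Type u) (L : Type v) [Field F] [NonUnitalNonAssocRing L] [Module F L] where
  carrier : Type u
  [addCommGroup : AddCommGroup carrier]
  [module : Module F carrier]
  [finite : FiniteDimensional F carrier]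
  left : L →ₗ[F] Module.End F carrier
  right : L →ₗ[F] Module.End F carrier
  llm : ∀ x y m, left (x * y) m = left x (left y m) - left y (left x m)
  lml : ∀ x y m, right y (left x m) = left x (right y m) - right (x * y) m
  mll : ∀ x y m, right y (right x m) = right (x * y) m - left x (right y m)

namespace FDBimod

attribute [instance] FDBimod.addCommGroup FDBimod.module FDBimod.finite

variable {F : Type u} {L : Type v} [Field F] [NonUnitalNonAssocRing L] [Module F L]

/-- Isomorphism of bimodules. -/
def Iso (M N : FDBimod F L) : Prop :=
  ∃ e : M.carrier ≃ₗ[F] N.carrier,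
    (∀ x m, e (M.left x m) = N.left x (e m)) ∧ (∀ x m, e (M.right x m) = N.right x (e m))

theorem Iso.refl (M : FDBimod F L) : Iso M M :=
  ⟨LinearEquiv.refl F _, fun _ _ => rfl, fun _ _ => rfl⟩

theorem Iso.symm {M N : FDBimod F L} : Iso M N → Iso N M := by
  rintro ⟨e, hl, hr⟩
  refine ⟨e.symm, fun x m => ?_, fun x m => ?_⟩
  · rw [LinearEquiv.symm_apply_eq, hl, LinearEquiv.apply_symm_apply]
  · rw [LinearEquiv.symm_apply_eq, hr, LinearEquiv.apply_symm_apply]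

theorem Iso.trans {M N P : FDBimod F L} : Iso M N → Iso N P → Iso M P := by
  rintro ⟨e, hl, hr⟩ ⟨e', hl', hr'⟩
  exact ⟨e.trans e', fun x m => by simp [hl, hl'], fun x m => by simp [hr, hr']⟩

/-- The subspace `p` is a subbimodule. -/
def IsSub (M : FDBimod F L) (p : Submodule F M.carrier) : Prop :=
  (∀ x, ∀ m ∈ p, M.left x m ∈ p) ∧ (∀ x, ∀ m ∈ p, M.right x m ∈ p)

/-- A subbimodule as a bimodule. -/
def sub (M : FDBimod F L) (p : Submodule F M.carrier) (h : M.IsSub p) : FDBimod F L where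
  carrier := p
  left := subAct M.left p h.1
  right := subAct M.right p h.2
  llm x y m := Subtype.ext (M.llm x y m)
  lml x y m := Subtype.ext (M.lml x y m)
  mll x y m := Subtype.ext (M.mll x y m)

/-- The quotient of a bimodule by a subbimodule. -/
def quot (M : FDBimod F L) (p : Submodule F M.carrier) (h : M.IsSub p) : FDBimod F L where
  carrier := M.carrier ⧸ p
  left := quotAct M.left p h.1
  right := quotAct M.right p h.2
  llm x y m := by
    obtain ⟨m, rfl⟩ := p.mkQ_surjective m
    exact congrArg p.mkQ (M.llm x y m)
  lml x y m := by
    obtain ⟨m, rfl⟩ := p.mkQ_surjective m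
    exact congrArg p.mkQ (M.lml x y m)
  mll x y m := by
    obtain ⟨m, rfl⟩ := p.mkQ_surjective m
    exact congrArg p.mkQ (M.mll x y m)

theorem IsSub.comap_subtype {M : FDBimod F L} {p q : Submodule F M.carrier} (hp : M.IsSub p)
    (hq : M.IsSub q) : (M.sub q hq).IsSub (p.comap q.subtype) :=
  ⟨fun x m hm => hp.1 x m.1 hm, fun x m hm => hp.2 x m.1 hm⟩

/-- The factor `q / (p ∩ q)` of two subbimodules, which is `q / p` if `p ≤ q`. -/
def factor (M : FDBimod F L) (p q : Submodule F M.carrier) (hp : M.IsSub p) (hq : M.IsSub q) :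
    FDBimod F L :=
  (M.sub q hq).quot (p.comap q.subtype) (hp.comap_subtype hq)

/-- Irreducible bimodules: non-zero, and without subbimodules other than `0` and everything. -/
def IsIrreducible (M : FDBimod F L) : Prop :=
  Nontrivial M.carrier ∧ ∀ p : Submodule F M.carrier, M.IsSub p → p = ⊥ ∨ p = ⊤

/-- A composition series `0 = M₀ ≤ M₁ ≤ ⋯ ≤ Mₙ = M` of subbimodules with irreducible factors. -/
structure CompSeries (M : FDBimod F L) where
  length : ℕ
  term : Fin (length + 1) → Submodule F M.carrier
  isSub : ∀ i, M.IsSub (term i)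
  bot : term 0 = ⊥
  top : term (Fin.last length) = ⊤
  mono : ∀ i : Fin length, term i.castSucc ≤ term i.succ
  irred : ∀ i : Fin length,
    (M.factor (term i.castSucc) (term i.succ) (isSub _) (isSub _)).IsIrreducible

/-- Every finite-dimensional bimodule has a composition series. -/
theorem nonempty_compSeries (M : FDBimod F L) : Nonempty M.CompSeries := by
  let α := {p : Submodule F M.carrier // M.IsSub p}
  have hbot : M.IsSub ⊥ := by
    constructor <;> intro x m hm <;> rw [Submodule.mem_bot] at hm ⊢ <;> rw [hm, map_zero]
  have htop : M.IsSub ⊤ := ⟨fun _ _ _ => trivial, fun _ _ _ => trivial⟩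
  have w1 : WellFoundedLT α :=
    ⟨InvImage.wf (fun p : α => p.1) (wellFounded_lt (α := Submodule F M.carrier))⟩
  have w2 : WellFoundedGT α :=
    ⟨InvImage.wf (fun p : α => p.1) (wellFounded_gt (α := Submodule F M.carrier))⟩
  have w3 : Nonempty α := ⟨⟨⊥, hbot⟩⟩
  obtain ⟨a, h0, n, hn, hc⟩ := exists_covBy_seq_of_wellFoundedLT_wellFoundedGT α
  refine ⟨⟨n, fun i => (a i).1, fun i => (a i).2, ?_, ?_, ?_, ?_⟩⟩
  · exact le_bot_iff.1 (h0 (b := ⟨⊥, hbot⟩) (bot_le (a := (a 0).1)))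
  · exact top_le_iff.1 (hn (b := ⟨⊤, htop⟩) (le_top (a := (a n).1)))
  · intro i
    exact (hc i.1 i.2).le
  · intro i
    have hci := hc i.1 i.2
    set p := a i.1 with hp
    set q := a (i.1 + 1) with hq
    change (M.factor p.1 q.1 p.2 q.2).IsIrreducible
    refine ⟨?_, fun r hr => ?_⟩
    · refine Submodule.Quotient.nontrivial_iff.2 fun h => ?_
      exact hci.lt.not_ge (Submodule.comap_subtype_eq_top.1 h)
    · let r' : Submodule F q.1 := r.comap (p.1.comap q.1.subtype).mkQ
      let s : Submodule F M.carrier := r'.map q.1.subtype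
      have hs : M.IsSub s := by
        constructor
        · rintro x _ ⟨m, hm, rfl⟩
          exact ⟨(M.sub q.1 q.2).left x m, hr.1 x _ hm, rfl⟩
        · rintro x _ ⟨m, hm, rfl⟩
          exact ⟨(M.sub q.1 q.2).right x m, hr.2 x _ hm, rfl⟩
      have hps : p.1 ≤ s := fun m hm =>
        ⟨⟨m, hci.le hm⟩, by
          change (p.1.comap q.1.subtype).mkQ ⟨m, hci.le hm⟩ ∈ r
          rw [show (p.1.comap q.1.subtype).mkQ ⟨m, hci.le hm⟩ = 0 from
            (Submodule.Quotient.mk_eq_zero _).2 hm]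
          exact r.zero_mem, rfl⟩
      have hsq : s ≤ q.1 := Submodule.map_subtype_le _ _
      have hmem : ∀ m : q.1, m.1 ∈ s → (p.1.comap q.1.subtype).mkQ m ∈ r := by
        rintro m ⟨m', hm', h⟩
        rwa [← show m' = m from Subtype.ext h]
      rcases hci.eq_or_eq (c := ⟨s, hs⟩) hps hsq with h | h
      · left
        refine le_bot_iff.1 fun z hz => ?_
        obtain ⟨m, rfl⟩ := (p.1.comap q.1.subtype).mkQ_surjective z
        refine (Submodule.Quotient.mk_eq_zero _).2 ?_
        have : m.1 ∈ s := ⟨m, hz, rfl⟩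
        rwa [show s = p.1 from congrArg Subtype.val h] at this
      · right
        refine top_le_iff.1 fun z _ => ?_
        obtain ⟨m, rfl⟩ := (p.1.comap q.1.subtype).mkQ_surjective z
        refine hmem m ?_
        rw [show s = q.1 from congrArg Subtype.val h]
        exact m.2

/-! ### The truncated tensor product -/

/-- `x · (m ⊗ n) = (x · m) ⊗ n + m ⊗ (x · n)`. -/
noncomputable def tensorLeft (M N : FDBimod F L) :
    L →ₗ[F] Module.End F (M.carrier ⊗[F] N.carrier) :=
  LinearMap.rTensorHom N.carrier ∘ₗ M.left + LinearMap.lTensorHom M.carrier ∘ₗ N.left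

/-- `(m ⊗ n) · x = (m · x) ⊗ n + m ⊗ (n · x)`. -/
noncomputable def tensorRight (M N : FDBimod F L) :
    L →ₗ[F] Module.End F (M.carrier ⊗[F] N.carrier) :=
  LinearMap.rTensorHom N.carrier ∘ₗ M.right + LinearMap.lTensorHom M.carrier ∘ₗ N.right

@[simp] theorem tensorLeft_tmul (M N : FDBimod F L) (x : L) (m : M.carrier) (n : N.carrier) :
    tensorLeft M N x (m ⊗ₜ n) = M.left x m ⊗ₜ[F] n + m ⊗ₜ[F] N.left x n := rfl

@[simp] theorem tensorRight_tmul (M N : FDBimod F L) (x : L) (m : M.carrier) (n : N.carrier) :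
    tensorRight M N x (m ⊗ₜ n) = M.right x m ⊗ₜ[F] n + m ⊗ₜ[F] N.right x n := rfl

/-- The set `S(M,N)` of all `(x·m + m·x) ⊗ (n·y) + (m·y) ⊗ (x·n + n·x)`. -/
def truncSet (M N : FDBimod F L) : Set (M.carrier ⊗[F] N.carrier) :=
  {t | ∃ (x y : L) (m : M.carrier) (n : N.carrier),
    t = (M.left x m + M.right x m) ⊗ₜ[F] N.right y n
      + M.right y m ⊗ₜ[F] (N.left x n + N.right x n)}

/-- `T(M,N)`: the smallest subspace of `M ⊗ N` that contains `S(M,N)` and is closed under both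
actions. -/
def truncSub (M N : FDBimod F L) : Submodule F (M.carrier ⊗[F] N.carrier) :=
  sInf {p | truncSet M N ⊆ p ∧ (∀ x, ∀ t ∈ p, tensorLeft M N x t ∈ p) ∧
    (∀ x, ∀ t ∈ p, tensorRight M N x t ∈ p)}

theorem truncSet_subset (M N : FDBimod F L) : truncSet M N ⊆ truncSub M N := by
  intro t ht
  exact Submodule.mem_sInf.2 fun p hp => hp.1 ht

theorem truncSub_left (M N : FDBimod F L) (x : L) (t) (ht : t ∈ truncSub M N) :
    tensorLeft M N x t ∈ truncSub M N :=
  Submodule.mem_sInf.2 fun p hp => hp.2.1 x t (Submodule.mem_sInf.1 ht p hp)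

theorem truncSub_right (M N : FDBimod F L) (x : L) (t) (ht : t ∈ truncSub M N) :
    tensorRight M N x t ∈ truncSub M N :=
  Submodule.mem_sInf.2 fun p hp => hp.2.2 x t (Submodule.mem_sInf.1 ht p hp)

theorem zd (M : FDBimod F L) (x y : L) (m : M.carrier) :
    M.right y (M.left x m) + M.right y (M.right x m) = 0 := by
  rw [M.lml, M.mll]; abel

theorem tensor_llm (M N : FDBimod F L) (x y : L) (t : M.carrier ⊗[F] N.carrier) :
    tensorLeft M N (x * y) t =
      tensorLeft M N x (tensorLeft M N y t) - tensorLeft M N y (tensorLeft M N x t) := by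
  induction t with
  | zero => simp
  | add a b ha hb => simp only [map_add, ha, hb]; abel
  | tmul m n =>
    simp only [tensorLeft_tmul, map_add, M.llm, N.llm, TensorProduct.sub_tmul,
      TensorProduct.tmul_sub]
    abel

theorem tensor_lml (M N : FDBimod F L) (x y : L) (t : M.carrier ⊗[F] N.carrier) :
    tensorRight M N y (tensorLeft M N x t) =
      tensorLeft M N x (tensorRight M N y t) - tensorRight M N (x * y) t := by
  induction t with
  | zero => simp
  | add a b ha hb => simp only [map_add, ha, hb]; abel
  | tmul m n =>
    simp only [tensorLeft_tmul, tensorRight_tmul, map_add, M.lml, N.lml, TensorProduct.sub_tmul,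
      TensorProduct.tmul_sub]
    abel

theorem tensor_zd (M N : FDBimod F L) (x y : L) (t : M.carrier ⊗[F] N.carrier) :
    tensorRight M N y (tensorLeft M N x t) + tensorRight M N y (tensorRight M N x t)
      ∈ truncSub M N := by
  induction t with
  | zero => simp
  | add a b ha hb =>
    simp only [map_add]
    rw [add_add_add_comm]
    exact add_mem ha hb
  | tmul m n =>
    refine truncSet_subset M N ⟨x, y, m, n, ?_⟩
    have h1 := congrArg (· ⊗ₜ[F] n) (M.zd x y m)
    have h2 := congrArg (m ⊗ₜ[F] ·) (N.zd x y n)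
    simp only [TensorProduct.add_tmul, TensorProduct.tmul_add, TensorProduct.zero_tmul,
      TensorProduct.tmul_zero] at h1 h2
    simp only [tensorLeft_tmul, tensorRight_tmul, map_add, TensorProduct.add_tmul,
      TensorProduct.tmul_add]
    rw [← sub_eq_zero, ← add_zero (0 : M.carrier ⊗[F] N.carrier)]
    nth_rewrite 1 [← h1]
    rw [← h2]
    abel

/-- The truncated tensor product `M ⊗̄ N = (M ⊗ N) / T(M,N)`. -/
noncomputable def truncTensor (M N : FDBimod F L) : FDBimod F L where
  carrier := (M.carrier ⊗[F] N.carrier) ⧸ truncSub M N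
  left := quotAct (tensorLeft M N) (truncSub M N) (truncSub_left M N)
  right := quotAct (tensorRight M N) (truncSub M N) (truncSub_right M N)
  llm x y t := by
    obtain ⟨t, rfl⟩ := (truncSub M N).mkQ_surjective t
    exact congrArg (truncSub M N).mkQ (tensor_llm M N x y t)
  lml x y t := by
    obtain ⟨t, rfl⟩ := (truncSub M N).mkQ_surjective t
    exact congrArg (truncSub M N).mkQ (tensor_lml M N x y t)
  mll x y t := by
    obtain ⟨t, rfl⟩ := (truncSub M N).mkQ_surjective t
    have h := (Submodule.Quotient.mk_eq_zero _).2 (tensor_zd M N x y t)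
    rw [tensor_lml] at h
    have h' := congrArg ((truncSub M N).mkQ (tensorRight M N (x * y) t)
      - (truncSub M N).mkQ (tensorLeft M N x (tensorRight M N y t)) + ·) h
    rw [add_zero] at h'
    refine Eq.trans ?_ h'
    change (truncSub M N).mkQ (tensorRight M N y (tensorRight M N x t)) = _ + (truncSub M N).mkQ _
    simp only [map_add, map_sub]
    abel

variable (F L) in
/-- The one-dimensional trivial bimodule. -/
def triv : FDBimod F L where
  carrier := F
  left := 0
  right := 0
  llm x y m := by simp
  lml x y m := by simp
  mll x y m := by simp

variable (F L) in
theorem triv_isIrreducible : (triv F L).IsIrreducible :=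
  ⟨inferInstanceAs (Nontrivial F), fun p _ => eq_bot_or_eq_top (α := Ideal F) p⟩

end FDBimod

/-! ### The Grothendieck ring -/

/-- The additive extension to the free abelian group on `X` of a map on `X`. -/
noncomputable def freeLift {X G : Type*} [AddCommGroup G] (f : X → G) : (X →₀ ℤ) →+ G :=
  Finsupp.liftAddHom fun x => zmultiplesHom G (f x)

theorem freeLift_single {X G : Type*} [AddCommGroup G] (f : X → G) (x : X) :
    freeLift f (Finsupp.single x 1) = f x :=
  (Finsupp.liftAddHom_apply_single _ _ _).trans (one_zsmul _)

section Grothendieck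

variable (F : Type u) (L : Type v) [Field F] [NonUnitalNonAssocRing L] [Module F L]

/-- Isomorphism on the irreducible finite-dimensional bimodules. -/
def irrSetoid : Setoid {M : FDBimod F L // M.IsIrreducible} where
  r M N := M.1.Iso N.1
  iseqv := ⟨fun M => .refl M.1, fun h => h.symm, fun h h' => h.trans h'⟩

/-- The set of isomorphism classes of irreducible finite-dimensional bimodules. -/
def Irr : Type (max (u + 1) v) := Quotient (irrSetoid F L)

variable {F L} in
/-- The isomorphism class of an irreducible bimodule. -/
def Irr.mk (M : FDBimod F L) (h : M.IsIrreducible) : Irr F L :=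
  Quotient.mk (irrSetoid F L) ⟨M, h⟩

variable {F L} in
/-- A bimodule in a given isomorphism class. -/
noncomputable def Irr.rep (S : Irr F L) : FDBimod F L := (Quotient.out S).1

/-- The Grothendieck group: the free abelian group on the isomorphism classes of irreducible
finite-dimensional bimodules. -/
def Gr : Type (max (u + 1) v) := Irr F L →₀ ℤ

noncomputable instance : AddCommGroup (Gr F L) := inferInstanceAs (AddCommGroup (Irr F L →₀ ℤ))

variable {F L} in
/-- The basis element of the Grothendieck group that belongs to an irreducible class. -/
noncomputable def Gr.of (S : Irr F L) : Gr F L := Finsupp.single S (1 : ℤ)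

variable {F L} in
/-- The class `[M] = ∑_S [M : S] [S]`: the sum of the classes of the factors of a composition series,
so that the coefficient at `S` is the number of composition factors isomorphic to `S`. By the
Jordan-Hölder theorem the choice of the series is immaterial, and `[M]` depends only on the
isomorphism class of `M`. -/
noncomputable def Gr.cls (M : FDBimod F L) : Gr F L :=
  let c : M.CompSeries := Classical.choice M.nonempty_compSeries
  ∑ i : Fin c.length, Gr.of (Irr.mk _ (c.irred i))

/-- The biadditive multiplication with `[M] · [N] = [M ⊗̄ N]` for irreducible `M` and `N`. -/
noncomputable def Gr.mulHom : Gr F L →+ Gr F L →+ Gr F L :=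
  freeLift fun S : Irr F L =>
    (freeLift fun S' : Irr F L => Gr.cls (S.rep.truncTensor S'.rep) : Gr F L →+ Gr F L)

noncomputable instance : NonUnitalNonAssocRing (Gr F L) where
  mul a b := Gr.mulHom F L a b
  left_distrib a b c := map_add (Gr.mulHom F L a) b c
  right_distrib a b c := by
    change Gr.mulHom F L (a + b) c = _
    rw [map_add]; rfl
  zero_mul a := by
    change Gr.mulHom F L 0 a = 0
    rw [map_zero]; rfl
  mul_zero a := map_zero (Gr.mulHom F L a)

theorem Gr.of_mul_of (S S' : Irr F L) :
    Gr.of S * Gr.of S' = Gr.cls (S.rep.truncTensor S'.rep) := by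
  change Gr.mulHom F L (Finsupp.single S 1) (Finsupp.single S' 1) = _
  exact (DFunLike.congr_fun (freeLift_single _ S) _).trans (freeLift_single _ S')

/-- The unity is the class of the one-dimensional trivial bimodule. -/
noncomputable instance : One (Gr F L) :=
  ⟨Gr.of (Irr.mk (FDBimod.triv F L) (FDBimod.triv_isIrreducible F L))⟩

end Grothendieck

/-! ### The unital commutative product -/

/-- A basis of the additive group of the unital commutative ring `A` that contains the unity. -/
structure UnitalBasis (ι : Type*) (A : Type*) [NonAssocCommRing A] where
  basis : Module.Basis ι ℤ A
  one : ι
  basis_one : basis one = 1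

section Product

variable {ι κ A B : Type*} [NonAssocCommRing A] [NonAssocCommRing B]

/-- The index set of the basis `{1} ∪ Ã ∪ B̃` of `A ⊛ B`: `none` stands for the unity, and `Ã`, `B̃`
are the bases of `A` and `B` without the unity. -/
abbrev UCPIndex (a : UnitalBasis ι A) (b : UnitalBasis κ B) : Type _ :=
  Option ({i : ι // i ≠ a.one} ⊕ {j : κ // j ≠ b.one})

/-- The unital commutative product `A ⊛ B` (with respect to the given bases): the free abelian group
on `{1} ∪ Ã ∪ B̃`. -/
def UCP (a : UnitalBasis ι A) (b : UnitalBasis κ B) : Type _ := UCPIndex a b →₀ ℤ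

namespace UCP

variable (a : UnitalBasis ι A) (b : UnitalBasis κ B)

noncomputable instance : AddCommGroup (UCP a b) := inferInstanceAs (AddCommGroup (UCPIndex a b →₀ ℤ))

variable {a b} in
/-- The basis elements of `A ⊛ B`. -/
noncomputable def of (x : UCPIndex a b) : UCP a b := Finsupp.single x (1 : ℤ)

open Classical in
/-- The additive embedding of `A` that sends the unity to `1` and every element of `Ã` to itself. -/
noncomputable def inl : A →ₗ[ℤ] UCP a b :=
  a.basis.constr ℤ fun i => if h : i = a.one then of none else of (some (.inl ⟨i, h⟩))

open Classical in
/-- The additive embedding of `B` that sends the unity to `1` and every element of `B̃` to itself. -/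
noncomputable def inr : B →ₗ[ℤ] UCP a b :=
  b.basis.constr ℤ fun j => if h : j = b.one then of none else of (some (.inr ⟨j, h⟩))

/-- The products of the basis elements. -/
noncomputable def basisMul : UCPIndex a b → UCPIndex a b → UCP a b
  | none, y => of y
  | x, none => of x
  | some (.inl i), some (.inl i') => inl a b (a.basis i * a.basis i')
  | some (.inr j), some (.inr j') => inr a b (b.basis j * b.basis j')
  | some (.inl _), some (.inr _) => 0
  | some (.inr _), some (.inl _) => 0

/-- The biadditive extension of `basisMul`. -/
noncomputable def mulHom : UCP a b →+ UCP a b →+ UCP a b :=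
  freeLift fun x : UCPIndex a b =>
    (freeLift fun y : UCPIndex a b => basisMul a b x y : UCP a b →+ UCP a b)

theorem mulHom_of (x y : UCPIndex a b) : mulHom a b (of x) (of y) = basisMul a b x y := by
  change mulHom a b (Finsupp.single x 1) (Finsupp.single y 1) = _
  exact (DFunLike.congr_fun (freeLift_single _ x) _).trans (freeLift_single _ y)

theorem basisMul_comm (x y : UCPIndex a b) : basisMul a b x y = basisMul a b y x := by
  rcases x with _ | _ | _ <;> rcases y with _ | _ | _ <;> simp [basisMul, mul_comm]

theorem basisMul_none (y : UCPIndex a b) : basisMul a b none y = of y := by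
  rcases y with _ | _ | _ <;> rfl

theorem addHom_ext {G : Type*} [AddCommGroup G] {f g : UCP a b →+ G}
    (h : ∀ x, f (of x) = g (of x)) : f = g :=
  Finsupp.addHom_ext' (M := ℤ) fun x => AddMonoidHom.ext_int (h x)

theorem mulHom_comm (s t : UCP a b) : mulHom a b s t = mulHom a b t s := by
  have : mulHom a b = (mulHom a b).flip := by
    refine addHom_ext a b fun x => addHom_ext a b fun y => ?_
    rw [AddMonoidHom.flip_apply, mulHom_of, mulHom_of, basisMul_comm]
  exact DFunLike.congr_fun (DFunLike.congr_fun this s) t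

theorem one_mulHom (t : UCP a b) : mulHom a b (of none) t = t := by
  have : mulHom a b (of none) = AddMonoidHom.id _ := by
    refine addHom_ext a b fun y => ?_
    rw [mulHom_of, basisMul_none, AddMonoidHom.id_apply]
  exact DFunLike.congr_fun this t

noncomputable instance : NonAssocCommRing (UCP a b) where
  mul s t := mulHom a b s t
  one := of none
  left_distrib s t r := map_add (mulHom a b s) t r
  right_distrib s t r := by
    change mulHom a b (s + t) r = _
    rw [map_add]; rfl
  zero_mul s := by
    change mulHom a b 0 s = 0
    rw [map_zero]; rfl
  mul_zero s := map_zero (mulHom a b s)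
  one_mul s := one_mulHom a b s
  mul_one s := (mulHom_comm a b s _).trans (one_mulHom a b s)
  mul_comm s t := mulHom_comm a b s t

end UCP

end Product

/-- The basis of the integral group ring `ℤ[G]` that consists of the group elements. -/
noncomputable def groupRingBasis (G : Type*) [AddCommGroup G] :
    UnitalBasis G (AddMonoidAlgebra ℤ G) where
  basis := AddMonoidAlgebra.basis G ℤ
  one := 0
  basis_one := by simp [AddMonoidAlgebra.one_def]

end LeibnizAlg

/-! In a bimodule, right multiplication by any `y` kills every `x · m + m · x` (`FDBimod.zd`), and
these elements span a subbimodule. In an irreducible bimodule that span is either zero, so that the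
right action is minus the left one (symmetric), or everything, so that the right action vanishes
(antisymmetric). In both cases a subspace stable on the left is a subbimodule. The left action
factors through the solvable Lie algebra `LLie F L`, so Lie's theorem makes every irreducible
bimodule one-dimensional (`IsIrreducible.exists_hasWeights`): it is given by a weight `σ` vanishing
on products, with right weight `-σ` or `0`. These weights form the dual of the abelianization of
`LLie F L`, hence a copy of `F ^ k` (`exists_weights`). The two families meet exactly in the trivial
bimodule.

For one-dimensional bimodules the generators of `T(M,N)` are multiples of pure tensors by one
explicit scalar (`HasWeights.trunc_generator`). It vanishes identically within each family, where
weights therefore add and a group ring appears; for non-trivial members of different families it is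
non-zero somewhere, so `T(M,N)` is everything and the product is zero. This is the multiplication
table of `⊛`. -/

namespace LeibnizAlg

/-! ### Solvability of the canonical Lie algebra, and functionals vanishing on products. -/

section Weights

variable {F : Type u} {L : Type v} [Field F] [NonUnitalNonAssocRing L] [Module F L]

variable [IsScalarTower F L L] [SMulCommClass F L L] [IsLeftLeibniz L]

/-- The projection turns products into brackets. This inclusion suffices to transfer solvability. -/
theorem derivedSeries_LLie_le (n : ℕ) :
    (LieAlgebra.derivedSeries F (LLie F L) n).toSubmodule ≤
      (derivedSeries F L n).map (toLLie F L) := by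
  induction n with
  | zero =>
    intro z _
    obtain ⟨x, rfl⟩ := toLLie_surjective F L z
    exact ⟨x, trivial, rfl⟩
  | succ n ih =>
    rw [LieAlgebra.derivedSeries_def, LieAlgebra.derivedSeriesOfIdeal_succ,
      LieSubmodule.lieIdeal_oper_eq_linear_span', Submodule.span_le]
    rintro _ ⟨a, ha, b, hb, rfl⟩
    obtain ⟨x, hx, rfl⟩ := ih ha
    obtain ⟨y, hy, rfl⟩ := ih hb
    exact ⟨x * y, Submodule.subset_span ⟨x, hx, y, hy, rfl⟩, toLLie_mul F L x y⟩

theorem isSolvable_LLie (h : IsSolvable F L) : LieAlgebra.IsSolvable (LLie F L) := by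
  obtain ⟨n, hn⟩ := h
  refine LieAlgebra.IsSolvable.mk (R := F) (k := n) ?_
  have := derivedSeries_LLie_le (F := F) (L := L) n
  rw [hn, Submodule.map_bot, le_bot_iff] at this
  simpa using this

variable (F L) in
/-- Linear functionals on `L` that vanish on products are parametrized by `F ^ abelianRank F L`. -/
theorem exists_weights [FiniteDimensional F (LLie F L)] :
    ∃ w : (Fin (abelianRank F L) → F) →ₗ[F] Module.Dual F L, Function.Injective w ∧
      ∀ σ : Module.Dual F L, σ ∈ LinearMap.range w ↔ ∀ x y, σ (x * y) = 0 := by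
  let I : Submodule F (LLie F L) :=
    (⁅(⊤ : LieIdeal F (LLie F L)), (⊤ : LieIdeal F (LLie F L))⁆ : LieIdeal F (LLie F L)).toSubmodule
  have hrank : Module.finrank F (LLie F L ⧸ I) = abelianRank F L := rfl
  let π : L →ₗ[F] LLie F L ⧸ I := I.mkQ ∘ₗ toLLie F L
  have hπ : Function.Surjective π := I.mkQ_surjective.comp (toLLie_surjective F L)
  have hI : I = Submodule.span F {m | ∃ x ∈ (⊤ : LieIdeal F (LLie F L)),
      ∃ n ∈ (⊤ : LieIdeal F (LLie F L)), ⁅x, n⁆ = m} :=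
    LieSubmodule.lieIdeal_oper_eq_linear_span' ..
  -- An arbitrary choice of coordinates: both sides have dimension `abelianRank F L`.
  let e : (Fin (abelianRank F L) → F) ≃ₗ[F] Module.Dual F (LLie F L ⧸ I) :=
    LinearEquiv.ofFinrankEq _ _ (by rw [Subspace.dual_finrank_eq, hrank, Module.finrank_fin_fun])
  refine ⟨π.dualMap ∘ₗ e.toLinearMap,
    (LinearMap.dualMap_injective_of_surjective hπ).comp e.injective, fun σ => ?_⟩
  constructor
  · rintro ⟨g, rfl⟩ x y
    have : π (x * y) = 0 := by
      refine (Submodule.Quotient.mk_eq_zero _).2 ?_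
      rw [hI, toLLie_mul]
      exact Submodule.subset_span ⟨_, trivial, _, trivial, rfl⟩
    simp [this]
  · intro h
    -- Squares and brackets both come from products, so `σ` descends first to `LLie F L` and then to
    -- its abelianization.
    have h1 : leibKer F L ≤ LinearMap.ker σ := by
      refine Submodule.span_le.2 ?_
      rintro _ ⟨x, rfl⟩
      exact h x x
    let σ' : LLie F L →ₗ[F] F := (leibKer F L).liftQ σ h1
    have hσ' : ∀ x, σ' (toLLie F L x) = σ x := fun x => rfl
    have h2 : I ≤ LinearMap.ker σ' := by
      rw [hI]
      refine Submodule.span_le.2 ?_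
      rintro _ ⟨a, -, b, -, rfl⟩
      obtain ⟨x, rfl⟩ := toLLie_surjective F L a
      obtain ⟨y, rfl⟩ := toLLie_surjective F L b
      change σ' _ = 0
      rw [← toLLie_mul, hσ', h]
    refine ⟨e.symm (I.liftQ σ' h2), ?_⟩
    ext x
    simp [π, hσ']

end Weights

/-! ### One-dimensional bimodules, their truncated tensor products, and the symmetric/antisymmetric
dichotomy. -/

namespace FDBimod

variable {F : Type u} {L : Type v} [Field F] [NonUnitalNonAssocRing L] [Module F L]

/-- One-dimensional bimodules on which `L` acts by the functionals `σ` (left) and `τ` (right). -/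
structure HasWeights (M : FDBimod F L) (σ τ : Module.Dual F L) : Prop where
  finrank : Module.finrank F M.carrier = 1
  left : ∀ x m, M.left x m = σ x • m
  right : ∀ x m, M.right x m = τ x • m

namespace HasWeights

variable {M N : FDBimod F L} {σ τ σ' τ' : Module.Dual F L}

theorem iso (h : M.HasWeights σ τ) (h' : N.HasWeights σ τ) : M.Iso N :=
  ⟨LinearEquiv.ofFinrankEq _ _ (h.finrank.trans h'.finrank.symm),
    fun x m => by rw [h.left, h'.left, map_smul], fun x m => by rw [h.right, h'.right, map_smul]⟩

theorem of_iso (h : M.HasWeights σ τ) (e : M.Iso N) : N.HasWeights σ τ := by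
  obtain ⟨e, hl, hr⟩ := e
  refine ⟨e.finrank_eq.symm.trans h.finrank, fun x m => ?_, fun x m => ?_⟩
  · obtain ⟨m, rfl⟩ := e.surjective m
    rw [← hl, h.left, map_smul]
  · obtain ⟨m, rfl⟩ := e.surjective m
    rw [← hr, h.right, map_smul]

theorem unique (h : M.HasWeights σ τ) (h' : M.HasWeights σ' τ') : σ = σ' ∧ τ = τ' := by
  have : Nontrivial M.carrier := Module.nontrivial_of_finrank_pos (R := F) (by simp [h.finrank])
  obtain ⟨m, hm⟩ := exists_ne (0 : M.carrier)
  exact ⟨LinearMap.ext fun x => smul_left_injective F hm ((h.left x m).symm.trans (h'.left x m)),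
    LinearMap.ext fun x => smul_left_injective F hm ((h.right x m).symm.trans (h'.right x m))⟩

theorem isIrreducible (h : M.HasWeights σ τ) : M.IsIrreducible := by
  have : IsSimpleModule F M.carrier := isSimpleModule_iff_finrank_eq_one.2 h.finrank
  exact ⟨Module.nontrivial_of_finrank_pos (R := F) (by simp [h.finrank]),
    fun p _ => eq_bot_or_eq_top p⟩

theorem tensorLeft_apply (h : M.HasWeights σ τ) (h' : N.HasWeights σ' τ') (x : L)
    (t : M.carrier ⊗[F] N.carrier) : tensorLeft M N x t = (σ + σ') x • t := by
  induction t with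
  | zero => simp
  | add a b ha hb => rw [map_add, ha, hb, smul_add]
  | tmul m n =>
    rw [tensorLeft_tmul, h.left, h'.left, TensorProduct.tmul_smul, TensorProduct.smul_tmul',
      LinearMap.add_apply, add_smul,
      TensorProduct.smul_tmul', TensorProduct.smul_tmul']

theorem tensorRight_apply (h : M.HasWeights σ τ) (h' : N.HasWeights σ' τ') (x : L)
    (t : M.carrier ⊗[F] N.carrier) : tensorRight M N x t = (τ + τ') x • t := by
  induction t with
  | zero => simp
  | add a b ha hb => rw [map_add, ha, hb, smul_add]
  | tmul m n =>
    rw [tensorRight_tmul, h.right, h'.right, TensorProduct.tmul_smul, TensorProduct.smul_tmul',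
      LinearMap.add_apply, add_smul,
      TensorProduct.smul_tmul', TensorProduct.smul_tmul']

/-- The scalar decides the whole truncated product: `T(M,N)` is zero if it vanishes for all `x`,
`y`, and everything otherwise. -/
theorem trunc_generator (h : M.HasWeights σ τ) (h' : N.HasWeights σ' τ') (x y : L)
    (m : M.carrier) (n : N.carrier) :
    (M.left x m + M.right x m) ⊗ₜ[F] N.right y n + M.right y m ⊗ₜ[F] (N.left x n + N.right x n) =
      ((σ x + τ x) * τ' y + τ y * (σ' x + τ' x)) • m ⊗ₜ[F] n := by
  rw [h.left, h.right, h.right, h'.left, h'.right, h'.right, ← add_smul, ← add_smul,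
    TensorProduct.smul_tmul_smul, TensorProduct.smul_tmul_smul, ← add_smul]

theorem truncTensor (h : M.HasWeights σ τ) (h' : N.HasWeights σ' τ')
    (h0 : ∀ x y, (σ x + τ x) * τ' y + τ y * (σ' x + τ' x) = 0) :
    (M.truncTensor N).HasWeights (σ + σ') (τ + τ') := by
  have hT : truncSub M N = ⊥ := by
    -- The zero subspace is itself one of those whose intersection defines `T(M,N)`.
    refine le_bot_iff.1 (sInf_le ⟨?_, ?_, ?_⟩)
    · rintro _ ⟨x, y, m, n, rfl⟩
      rw [trunc_generator h h', h0, zero_smul]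
      exact zero_mem _
    · intro x t ht
      rw [(Submodule.mem_bot F).1 ht, map_zero]
      exact zero_mem _
    · intro x t ht
      rw [(Submodule.mem_bot F).1 ht, map_zero]
      exact zero_mem _
  refine ⟨?_, fun x t => ?_, fun x t => ?_⟩
  · change Module.finrank F ((M.carrier ⊗[F] N.carrier) ⧸ truncSub M N) = 1
    rw [((truncSub M N).quotEquivOfEqBot hT).finrank_eq, Module.finrank_tensorProduct, h.finrank,
      h'.finrank]
  · obtain ⟨t, rfl⟩ := (truncSub M N).mkQ_surjective t
    exact congrArg (truncSub M N).mkQ (tensorLeft_apply h h' x t)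
  · obtain ⟨t, rfl⟩ := (truncSub M N).mkQ_surjective t
    exact congrArg (truncSub M N).mkQ (tensorRight_apply h h' x t)

theorem subsingleton_truncTensor (h : M.HasWeights σ τ) (h' : N.HasWeights σ' τ') (x y : L)
    (h0 : (σ x + τ x) * τ' y + τ y * (σ' x + τ' x) ≠ 0) :
    Subsingleton (M.truncTensor N).carrier := by
  refine Submodule.Quotient.subsingleton_iff.2 (top_le_iff.1 ?_)
  rw [← TensorProduct.span_tmul_eq_top]
  refine Submodule.span_le.2 ?_
  rintro _ ⟨m, n, rfl⟩
  have hm : ((σ x + τ x) * τ' y + τ y * (σ' x + τ' x)) • m ⊗ₜ[F] n ∈ truncSub M N :=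
    truncSet_subset M N ⟨x, y, m, n, (trunc_generator h h' x y m n).symm⟩
  -- The scalar does not depend on `m` and `n`, so one pair `x`, `y` puts every pure tensor into
  -- `T(M,N)`.
  exact ((truncSub M N).smul_mem_iff h0).1 hm

end HasWeights

/-- The one-dimensional symmetric bimodule of weight `σ`. -/
def symOf (σ : Module.Dual F L) (hσ : ∀ x y, σ (x * y) = 0) : FDBimod F L where
  carrier := F
  left := LinearMap.lsmul F F ∘ₗ σ
  right := LinearMap.lsmul F F ∘ₗ (-σ)
  llm x y m := by simp [hσ, mul_left_comm]
  lml x y m := by simp [hσ, mul_left_comm]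
  mll x y m := by simp [hσ, mul_left_comm]

/-- The one-dimensional antisymmetric bimodule of weight `σ`. -/
def antiOf (σ : Module.Dual F L) (hσ : ∀ x y, σ (x * y) = 0) : FDBimod F L where
  carrier := F
  left := LinearMap.lsmul F F ∘ₗ σ
  right := 0
  llm x y m := by simp [hσ, mul_left_comm]
  lml x y m := by simp
  mll x y m := by simp

theorem symOf_hasWeights (σ : Module.Dual F L) (hσ : ∀ x y, σ (x * y) = 0) :
    (symOf σ hσ).HasWeights σ (-σ) :=
  ⟨Module.finrank_self F, fun _ _ => rfl, fun _ _ => rfl⟩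

theorem antiOf_hasWeights (σ : Module.Dual F L) (hσ : ∀ x y, σ (x * y) = 0) :
    (antiOf σ hσ).HasWeights σ 0 :=
  ⟨Module.finrank_self F, fun _ _ => rfl, fun _ m => (zero_smul F m).symm⟩

theorem triv_hasWeights : (triv F L).HasWeights 0 0 :=
  ⟨Module.finrank_self F, fun _ m => (zero_smul F m).symm, fun _ m => (zero_smul F m).symm⟩

/-- The kernel of antisymmetry, spanned by all `x · m + m · x`, is a subbimodule. -/
theorem isSub_span_left_add_right (M : FDBimod F L) :
    M.IsSub (Submodule.span F {t | ∃ x m, t = M.left x m + M.right x m}) := by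
  set W : Submodule F M.carrier :=
    Submodule.span F {t | ∃ x m, t = M.left x m + M.right x m}
  constructor
  · intro y
    suffices h : W ≤ W.comap (M.left y) from fun m hm => h hm
    refine Submodule.span_le.2 ?_
    rintro _ ⟨x, m, rfl⟩
    -- The result is the generator for `x` and `y · m` plus the generator for `y * x` and `m`.
    have e : M.left y (M.left x m + M.right x m) =
        (M.left x (M.left y m) + M.right x (M.left y m)) +
          (M.left (y * x) m + M.right (y * x) m) := by
      rw [map_add, M.lml, M.llm]
      abel
    change M.left y _ ∈ W
    rw [e]
    exact add_mem (Submodule.subset_span ⟨_, _, rfl⟩) (Submodule.subset_span ⟨_, _, rfl⟩)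
  · intro y
    suffices h : W ≤ W.comap (M.right y) from fun m hm => h hm
    refine Submodule.span_le.2 ?_
    rintro _ ⟨x, m, rfl⟩
    change M.right y _ ∈ W
    rw [map_add, M.zd]
    exact zero_mem _

/-- An irreducible bimodule is symmetric or antisymmetric. -/
theorem IsIrreducible.symm_or_anti {M : FDBimod F L} (h : M.IsIrreducible) :
    (∀ x, M.right x = -M.left x) ∨ ∀ x, M.right x = 0 := by
  -- If the span is zero, the bimodule is symmetric by definition; if it is everything, `zd` kills
  -- the right action.
  rcases h.2 _ M.isSub_span_left_add_right with h0 | h0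
  · left
    intro x
    ext m
    have : M.left x m + M.right x m ∈
        Submodule.span F {t | ∃ x m, t = M.left x m + M.right x m} :=
      Submodule.subset_span ⟨x, m, rfl⟩
    rw [h0, Submodule.mem_bot, add_comm] at this
    exact eq_neg_of_add_eq_zero_left this
  · right
    intro y
    have : (⊤ : Submodule F M.carrier) ≤ LinearMap.ker (M.right y) := by
      rw [← h0]
      refine Submodule.span_le.2 ?_
      rintro _ ⟨x, m, rfl⟩
      change M.right y _ = 0
      rw [map_add, M.zd]
    exact LinearMap.ker_eq_top.1 (top_le_iff.1 this)

/-! ### Lie's theorem and the one-dimensionality of irreducible bimodules. -/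

section Lie

variable [IsScalarTower F L L] [SMulCommClass F L L] [IsLeftLeibniz L]

attribute [local instance 100] LieRing.ofAssociativeRing

/-- The left action of a bimodule, as a representation of the canonical Lie algebra. -/
def leftRep (M : FDBimod F L) : LLie F L →ₗ⁅F⁆ Module.End F M.carrier where
  toLinearMap := (leibKer F L).liftQ M.left (by
    refine Submodule.span_le.2 ?_
    rintro _ ⟨x, rfl⟩
    change M.left (x * x) = 0
    ext m
    rw [M.llm, sub_self, LinearMap.zero_apply])
  map_lie' {a b} := by
    obtain ⟨x, rfl⟩ := toLLie_surjective F L a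
    obtain ⟨y, rfl⟩ := toLLie_surjective F L b
    rw [← toLLie_mul]
    change M.left (x * y) = ⁅M.left x, M.left y⁆
    ext m
    rw [M.llm]
    rfl

/-- By Lie's theorem, the left action on a non-zero bimodule has a common eigenvector. -/
theorem exists_left_eigenvector [IsAlgClosed F] [CharZero F] (hL : IsSolvable F L)
    (M : FDBimod F L) [Nontrivial M.carrier] :
    ∃ (σ : Module.Dual F L) (m : M.carrier), m ≠ 0 ∧ ∀ x, M.left x m = σ x • m := by
  have := isSolvable_LLie hL
  let i1 : LieRingModule (LLie F L) M.carrier := LieRingModule.compLieHom M.carrier M.leftRep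
  let i2 : LieModule F (LLie F L) M.carrier := LieModule.compLieHom M.carrier M.leftRep
  obtain ⟨χ, hχ⟩ := LieModule.exists_nontrivial_weightSpace_of_isSolvable F (LLie F L) M.carrier
  obtain ⟨⟨m, hm⟩, hm0⟩ := exists_ne (0 : LieModule.weightSpace M.carrier χ)
  rw [LieModule.mem_weightSpace] at hm
  exact ⟨χ ∘ₗ toLLie F L, m, by simpa using hm0, fun x => hm (toLLie F L x)⟩

/-- Irreducible bimodules of a solvable Leibniz algebra are one-dimensional. -/
theorem IsIrreducible.exists_hasWeights [IsAlgClosed F] [CharZero F] (hL : IsSolvable F L)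
    {M : FDBimod F L} (h : M.IsIrreducible) :
    ∃ σ : Module.Dual F L, (∀ x y, σ (x * y) = 0) ∧
      (M.HasWeights σ (-σ) ∨ M.HasWeights σ 0) := by
  have := h.1
  obtain ⟨σ, m, hm, hσ⟩ := M.exists_left_eigenvector hL
  have hl : ∀ x, ∀ n ∈ F ∙ m, M.left x n ∈ F ∙ m := by
    intro x n hn
    obtain ⟨c, rfl⟩ := Submodule.mem_span_singleton.1 hn
    rw [map_smul, hσ]
    exact Submodule.smul_mem _ _ (Submodule.smul_mem _ _ (Submodule.mem_span_singleton_self m))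
  have hsub : M.IsSub (F ∙ m) := by
    refine ⟨hl, fun x n hn => ?_⟩
    -- The right action is minus the left action or zero, so stability of the line under the left
    -- action is enough.
    rcases h.symm_or_anti with hr | hr
    · rw [hr]
      exact neg_mem (hl x n hn)
    · rw [hr]
      exact zero_mem _
  have htop : F ∙ m = ⊤ :=
    (h.2 _ hsub).resolve_left fun h0 => hm (Submodule.span_singleton_eq_bot.1 h0)
  have hleft : ∀ x n, M.left x n = σ x • n := by
    intro x n
    obtain ⟨c, rfl⟩ := Submodule.mem_span_singleton.1 (htop ▸ Submodule.mem_top : n ∈ F ∙ m)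
    rw [map_smul, hσ, smul_comm]
  have hrank : Module.finrank F M.carrier = 1 := by
    rw [← finrank_top, ← htop, finrank_span_singleton hm]
  refine ⟨σ, fun x y => ?_, ?_⟩
  -- Products act by commutators, and the operators here are scalars.
  · have := M.llm x y m
    simp only [hleft, smul_smul] at this
    rw [mul_comm, sub_self] at this
    exact (smul_eq_zero.1 this).resolve_right hm
  · rcases h.symm_or_anti with hr | hr
    · exact .inl ⟨hrank, hleft, fun x n => by
        rw [hr, LinearMap.neg_apply, hleft, LinearMap.neg_apply, neg_smul]⟩
    · exact .inr ⟨hrank, hleft, fun x n => by rw [hr]; exact (zero_smul F n).symm⟩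

end Lie

/-! ### Composition series and classes of zero and irreducible bimodules. -/

theorem CompSeries.term_lt {M : FDBimod F L} (c : M.CompSeries) (i : Fin c.length) :
    c.term i.castSucc < c.term i.succ := by
  refine lt_of_le_not_ge (c.mono i) fun h => ?_
  exact Submodule.Quotient.nontrivial_iff.1 (c.irred i).1 (Submodule.comap_subtype_eq_top.2 h)

theorem factor_bot_top_iso (M : FDBimod F L) {p q : Submodule F M.carrier} (hp : M.IsSub p)
    (hq : M.IsSub q) (hp' : p = ⊥) (hq' : q = ⊤) : (M.factor p q hp hq).Iso M := by
  subst hp' hq'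
  let e : ((⊤ : Submodule F M.carrier) ⧸
      (⊥ : Submodule F M.carrier).comap (⊤ : Submodule F M.carrier).subtype) ≃ₗ[F] M.carrier :=
    (Submodule.quotEquivOfEqBot _ (by simp)).trans Submodule.topEquiv
  refine ⟨e, fun x t => ?_, fun x t => ?_⟩
  all_goals
    obtain ⟨t, rfl⟩ := Submodule.mkQ_surjective _ t
    rfl

end FDBimod

section Grothendieck

open FDBimod

variable {F : Type u} {L : Type v} [Field F] [NonUnitalNonAssocRing L] [Module F L]

theorem Irr.mk_eq_mk_iff {M N : FDBimod F L} (hM : M.IsIrreducible) (hN : N.IsIrreducible) :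
    Irr.mk M hM = Irr.mk N hN ↔ M.Iso N :=
  Quotient.eq (r := irrSetoid F L)

theorem Irr.rep_mk_iso {M : FDBimod F L} (hM : M.IsIrreducible) : (Irr.mk M hM).rep.Iso M :=
  Quotient.mk_out (s := irrSetoid F L) ⟨M, hM⟩

theorem Gr.cls_of_subsingleton (M : FDBimod F L) [Subsingleton M.carrier] : Gr.cls M = 0 := by
  have : IsEmpty (Fin (Classical.choice M.nonempty_compSeries).length) :=
    ⟨fun i => (CompSeries.term_lt _ i).ne (Subsingleton.elim _ _)⟩
  exact Finset.sum_of_isEmpty _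

/-- The series in `Gr.cls` is an arbitrary choice, but strictness forces each step to run from `⊥`
to `⊤`, so there is exactly one. Every product of irreducible classes here is zero or irreducible,
so Jordan-Hölder is never needed. -/
theorem Gr.cls_of_isIrreducible (M : FDBimod F L) (h : M.IsIrreducible) :
    Gr.cls M = Gr.of (Irr.mk M h) := by
  unfold Gr.cls
  extract_lets c
  have hbt : ∀ i : Fin c.length, c.term i.castSucc = ⊥ ∧ c.term i.succ = ⊤ := fun i =>
    ⟨(h.2 _ (c.isSub _)).resolve_right (c.term_lt i).ne_top,
      (h.2 _ (c.isSub _)).resolve_left (c.term_lt i).ne_bot⟩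
  have := h.1
  have hlen : c.length = 1 := by
    -- Length `0` would give `⊥ = ⊤`; with length at least `2`, the term of index `1` would be `⊤`
    -- as the end of one step and `⊥` as the start of the next.
    rcases Nat.lt_trichotomy c.length 1 with h1 | h1 | h1
    · have h0 : Fin.last c.length = 0 := Fin.ext (by simp; omega)
      exact absurd (c.bot.symm.trans (h0 ▸ c.top)) bot_ne_top
    · exact h1
    · have h0 := (hbt ⟨0, by omega⟩).2
      have h2 := (hbt ⟨1, h1⟩).1
      exact absurd (h2.symm.trans h0) bot_ne_top
  rw [Finset.sum_congr rfl fun i _ => congrArg Gr.of ((Irr.mk_eq_mk_iff (c.irred i) h).2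
    (factor_bot_top_iso M _ _ (hbt i).1 (hbt i).2))]
  simp [hlen]

variable {M N : FDBimod F L} {σ τ σ' τ' : Module.Dual F L}

/-- The product is computed on chosen representatives, which have the same weights as `M` and `N`.
Weights determine the isomorphism class, so any model `P` of the summed weights will do. -/
theorem Gr.of_mul_of_eq_of (hM : M.HasWeights σ τ) (hN : N.HasWeights σ' τ')
    (h0 : ∀ x y, (σ x + τ x) * τ' y + τ y * (σ' x + τ' x) = 0) {P : FDBimod F L}
    (hP : P.HasWeights (σ + σ') (τ + τ')) :
    Gr.of (Irr.mk M hM.isIrreducible) * Gr.of (Irr.mk N hN.isIrreducible) =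
      Gr.of (Irr.mk P hP.isIrreducible) := by
  have h := (hM.of_iso (Irr.rep_mk_iso hM.isIrreducible).symm).truncTensor
    (hN.of_iso (Irr.rep_mk_iso hN.isIrreducible).symm) h0
  rw [Gr.of_mul_of, Gr.cls_of_isIrreducible _ h.isIrreducible]
  exact congrArg Gr.of ((Irr.mk_eq_mk_iff _ _).2 (h.iso hP))

theorem Gr.of_mul_of_eq_zero (hM : M.HasWeights σ τ) (hN : N.HasWeights σ' τ') (x y : L)
    (h0 : (σ x + τ x) * τ' y + τ y * (σ' x + τ' x) ≠ 0) :
    Gr.of (Irr.mk M hM.isIrreducible) * Gr.of (Irr.mk N hN.isIrreducible) = 0 := by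
  have := (hM.of_iso (Irr.rep_mk_iso hM.isIrreducible).symm).subsingleton_truncTensor
    (hN.of_iso (Irr.rep_mk_iso hN.isIrreducible).symm) x y h0
  rw [Gr.of_mul_of, Gr.cls_of_subsingleton]

end Grothendieck

end LeibnizAlg
namespace LeibnizAlg

open FDBimod

/-! ### The two families of irreducible classes and their multiplication table. -/

section Classes

variable {F : Type u} {L : Type v} [Field F] [NonUnitalNonAssocRing L] [Module F L]

/-- The class of the one-dimensional symmetric bimodule of weight `σ`. -/
def Irr.sym (σ : Module.Dual F L) (hσ : ∀ x y, σ (x * y) = 0) : Irr F L :=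
  Irr.mk (symOf σ hσ) (symOf_hasWeights σ hσ).isIrreducible

/-- The class of the one-dimensional antisymmetric bimodule of weight `σ`. -/
def Irr.anti (σ : Module.Dual F L) (hσ : ∀ x y, σ (x * y) = 0) : Irr F L :=
  Irr.mk (antiOf σ hσ) (antiOf_hasWeights σ hσ).isIrreducible

variable (F L) in
/-- The class of the one-dimensional trivial bimodule. -/
def Irr.triv : Irr F L := Irr.mk (FDBimod.triv F L) (FDBimod.triv_isIrreducible F L)

namespace Irr

variable {σ τ : Module.Dual F L} (hσ : ∀ x y, σ (x * y) = 0) (hτ : ∀ x y, τ (x * y) = 0)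

theorem sym_zero (h0 : σ = 0) : Irr.sym σ hσ = Irr.triv F L := by
  subst h0
  exact (mk_eq_mk_iff _ _).2 ((symOf_hasWeights _ hσ).iso (by simpa using triv_hasWeights))

theorem anti_zero (h0 : σ = 0) : Irr.anti σ hσ = Irr.triv F L := by
  subst h0
  exact (mk_eq_mk_iff _ _).2 ((antiOf_hasWeights _ hσ).iso triv_hasWeights)

theorem eq_of_sym_eq_sym (h : Irr.sym σ hσ = Irr.sym τ hτ) : σ = τ :=
  (((symOf_hasWeights σ hσ).of_iso ((mk_eq_mk_iff _ _).1 h)).unique (symOf_hasWeights τ hτ)).1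

theorem eq_of_anti_eq_anti (h : Irr.anti σ hσ = Irr.anti τ hτ) : σ = τ :=
  (((antiOf_hasWeights σ hσ).of_iso ((mk_eq_mk_iff _ _).1 h)).unique (antiOf_hasWeights τ hτ)).1

/-- The right weights `-σ` and `0` must agree. -/
theorem eq_zero_of_sym_eq_anti (h : Irr.sym σ hσ = Irr.anti τ hτ) : σ = 0 :=
  neg_eq_zero.1
    (((symOf_hasWeights σ hσ).of_iso ((mk_eq_mk_iff _ _).1 h)).unique (antiOf_hasWeights τ hτ)).2

theorem eq_zero_of_sym_eq_triv (h : Irr.sym σ hσ = Irr.triv F L) : σ = 0 :=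
  (((symOf_hasWeights σ hσ).of_iso ((mk_eq_mk_iff _ _).1 h)).unique triv_hasWeights).1

theorem eq_zero_of_anti_eq_triv (h : Irr.anti σ hσ = Irr.triv F L) : σ = 0 :=
  (((antiOf_hasWeights σ hσ).of_iso ((mk_eq_mk_iff _ _).1 h)).unique triv_hasWeights).1

theorem eq_sym_or_anti [IsScalarTower F L L] [SMulCommClass F L L] [IsLeftLeibniz L]
    [IsAlgClosed F] [CharZero F] (hL : IsSolvable F L) (S : Irr F L) :
    ∃ (σ : Module.Dual F L) (hσ : ∀ x y, σ (x * y) = 0), S = Irr.sym σ hσ ∨ S = Irr.anti σ hσ := by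
  obtain ⟨⟨M, hM⟩, rfl⟩ := Quotient.exists_rep S
  obtain ⟨σ, hσ, h | h⟩ := hM.exists_hasWeights hL
  · exact ⟨σ, hσ, .inl ((mk_eq_mk_iff hM _).2 (h.iso (symOf_hasWeights σ hσ)))⟩
  · exact ⟨σ, hσ, .inr ((mk_eq_mk_iff hM _).2 (h.iso (antiOf_hasWeights σ hσ)))⟩

end Irr

namespace Gr

variable {σ τ : Module.Dual F L} (hσ : ∀ x y, σ (x * y) = 0) (hτ : ∀ x y, τ (x * y) = 0)

theorem sym_mul_sym (hστ : ∀ x y, (σ + τ) (x * y) = 0) :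
    Gr.of (Irr.sym σ hσ) * Gr.of (Irr.sym τ hτ) = Gr.of (Irr.sym (σ + τ) hστ) := by
  refine of_mul_of_eq_of (symOf_hasWeights σ hσ) (symOf_hasWeights τ hτ) (fun x y => by simp)
    (P := symOf (σ + τ) hστ) ?_
  rw [← neg_add]
  exact symOf_hasWeights _ hστ

theorem anti_mul_anti (hστ : ∀ x y, (σ + τ) (x * y) = 0) :
    Gr.of (Irr.anti σ hσ) * Gr.of (Irr.anti τ hτ) = Gr.of (Irr.anti (σ + τ) hστ) := by
  refine of_mul_of_eq_of (antiOf_hasWeights σ hσ) (antiOf_hasWeights τ hτ) (fun x y => by simp)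
    (P := antiOf (σ + τ) hστ) ?_
  rw [zero_add]
  exact antiOf_hasWeights _ hστ

/-- The deciding scalar is `-σ y * τ x`, non-zero once `y` and `x` are chosen off the two kernels.
-/
theorem sym_mul_anti (h1 : σ ≠ 0) (h2 : τ ≠ 0) :
    Gr.of (Irr.sym σ hσ) * Gr.of (Irr.anti τ hτ) = 0 := by
  obtain ⟨y, hy⟩ := DFunLike.ne_iff.1 h1
  obtain ⟨x, hx⟩ := DFunLike.ne_iff.1 h2
  rw [LinearMap.zero_apply] at hx hy
  exact of_mul_of_eq_zero (symOf_hasWeights σ hσ) (antiOf_hasWeights τ hτ) x y (by simp [hx, hy])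

theorem anti_mul_sym (h1 : σ ≠ 0) (h2 : τ ≠ 0) :
    Gr.of (Irr.anti σ hσ) * Gr.of (Irr.sym τ hτ) = 0 := by
  obtain ⟨x, hx⟩ := DFunLike.ne_iff.1 h1
  obtain ⟨y, hy⟩ := DFunLike.ne_iff.1 h2
  rw [LinearMap.zero_apply] at hx hy
  exact of_mul_of_eq_zero (antiOf_hasWeights σ hσ) (symOf_hasWeights τ hτ) x y (by simp [hx, hy])

/-- The trivial class is the weight-zero member of both families, so it can be read in the family of
`S`, where weights add. -/
theorem triv_mul [IsScalarTower F L L] [SMulCommClass F L L] [IsLeftLeibniz L]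
    [IsAlgClosed F] [CharZero F] (hL : IsSolvable F L) (S : Irr F L) :
    Gr.of (Irr.triv F L) * Gr.of S = Gr.of S := by
  have h0 : ∀ x y : L, (0 : Module.Dual F L) (x * y) = 0 := fun _ _ => rfl
  obtain ⟨σ, hσ, rfl | rfl⟩ := S.eq_sym_or_anti hL
  · rw [← Irr.sym_zero h0 rfl, sym_mul_sym h0 hσ (by simpa using hσ)]
    simp only [zero_add]
  · rw [← Irr.anti_zero h0 rfl, anti_mul_anti h0 hσ (by simpa using hσ)]
    simp only [zero_add]

theorem mul_triv [IsScalarTower F L L] [SMulCommClass F L L] [IsLeftLeibniz L]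
    [IsAlgClosed F] [CharZero F] (hL : IsSolvable F L) (S : Irr F L) :
    Gr.of S * Gr.of (Irr.triv F L) = Gr.of S := by
  have h0 : ∀ x y : L, (0 : Module.Dual F L) (x * y) = 0 := fun _ _ => rfl
  obtain ⟨σ, hσ, rfl | rfl⟩ := S.eq_sym_or_anti hL
  · rw [← Irr.sym_zero h0 rfl, sym_mul_sym hσ h0 (by simpa using hσ)]
    simp only [add_zero]
  · rw [← Irr.anti_zero h0 rfl, anti_mul_anti hσ h0 (by simpa using hσ)]
    simp only [add_zero]

end Gr

end Classes

/-! ### Basis elements in `A ⊛ B` and in group rings. -/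

namespace UCP

variable {ι κ A B : Type*} [NonAssocCommRing A] [NonAssocCommRing B]
  (a : UnitalBasis ι A) (b : UnitalBasis κ B)

theorem inl_basis_one : inl a b (a.basis a.one) = of none := by
  rw [inl, Module.Basis.constr_basis, dif_pos rfl]

theorem inr_basis_one : inr a b (b.basis b.one) = of none := by
  rw [inr, Module.Basis.constr_basis, dif_pos rfl]

theorem inl_basis {i : ι} (h : i ≠ a.one) : inl a b (a.basis i) = of (some (.inl ⟨i, h⟩)) := by
  rw [inl, Module.Basis.constr_basis, dif_neg h]

theorem inr_basis {j : κ} (h : j ≠ b.one) : inr a b (b.basis j) = of (some (.inr ⟨j, h⟩)) := by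
  rw [inr, Module.Basis.constr_basis, dif_neg h]

end UCP

theorem groupRingBasis_mul (G : Type*) [AddCommGroup G] (g h : G) :
    (groupRingBasis G).basis g * (groupRingBasis G).basis h = (groupRingBasis G).basis (g + h) := by
  simp [groupRingBasis, AddMonoidAlgebra.single_mul_single]

/-! ### Matching bases and multiplication tables. -/

section Isomorphism

variable {F : Type u} {L : Type v} [Field F] [NonUnitalNonAssocRing L] [Module F L]
variable {G : Type*} [AddCommGroup G] (w : G →+ Module.Dual F L)

/-- The irreducible bimodule that belongs to a basis element of `ℤ[G] ⊛ ℤ[G]`, where `G` is a group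
of weights. -/
def classOfIndex (hw : ∀ g x y, w g (x * y) = 0) :
    UCPIndex (groupRingBasis G) (groupRingBasis G) → Irr F L
  | none => Irr.triv F L
  | some (.inl i) => Irr.sym (w i.1) (hw i.1)
  | some (.inr j) => Irr.anti (w j.1) (hw j.1)

variable {w}

/-- Indices other than `none` carry non-zero weights because `w` is injective, while a coincidence
between the families or with the trivial class forces a zero weight. -/
theorem classOfIndex_injective (hw : ∀ g x y, w g (x * y) = 0)
    (hinj : Function.Injective w) :
    Function.Injective (classOfIndex w hw) := by
  have h0 : ∀ {g : G}, g ≠ (groupRingBasis G).one → w g ≠ 0 := fun hg h =>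
    hg (hinj (h.trans (map_zero w).symm))
  rintro (_ | ⟨i, hi⟩ | ⟨i, hi⟩) (_ | ⟨j, hj⟩ | ⟨j, hj⟩) h
  · rfl
  · exact absurd (Irr.eq_zero_of_sym_eq_triv _ h.symm) (h0 hj)
  · exact absurd (Irr.eq_zero_of_anti_eq_triv _ h.symm) (h0 hj)
  · exact absurd (Irr.eq_zero_of_sym_eq_triv _ h) (h0 hi)
  · obtain rfl := hinj (Irr.eq_of_sym_eq_sym _ _ h)
    rfl
  · exact absurd (Irr.eq_zero_of_sym_eq_anti _ _ h) (h0 hi)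
  · exact absurd (Irr.eq_zero_of_anti_eq_triv _ h) (h0 hi)
  · exact absurd (Irr.eq_zero_of_sym_eq_anti _ _ h.symm) (h0 hj)
  · obtain rfl := hinj (Irr.eq_of_anti_eq_anti _ _ h)
    rfl

variable [IsScalarTower F L L] [SMulCommClass F L L] [IsLeftLeibniz L]
variable [IsAlgClosed F] [CharZero F]

theorem classOfIndex_surjective (hw : ∀ g x y, w g (x * y) = 0)
    (hL : IsSolvable F L)
    (hsurj : ∀ σ : Module.Dual F L, (∀ x y, σ (x * y) = 0) → ∃ g, w g = σ) :
    Function.Surjective (classOfIndex w hw) := by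
  intro S
  obtain ⟨σ, hσ, hS⟩ := S.eq_sym_or_anti hL
  obtain ⟨g, rfl⟩ := hsurj σ hσ
  by_cases hg : g = (groupRingBasis G).one
  · refine ⟨none, ?_⟩
    have h0 : w g = 0 := by rw [hg]; exact map_zero w
    rcases hS with rfl | rfl
    · exact (Irr.sym_zero hσ h0).symm
    · exact (Irr.anti_zero hσ h0).symm
  · rcases hS with rfl | rfl
    · exact ⟨some (.inl ⟨g, hg⟩), rfl⟩
    · exact ⟨some (.inr ⟨g, hg⟩), rfl⟩

/-- A group `G` of weights identifies the Grothendieck ring with `ℤ[G] ⊛ ℤ[G]`. -/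
theorem exists_ringEquiv (hw : ∀ g x y, w g (x * y) = 0) (hL : IsSolvable F L)
    (hinj : Function.Injective w)
    (hsurj : ∀ σ : Module.Dual F L, (∀ x y, σ (x * y) = 0) → ∃ g, w g = σ) :
    ∃ e : Gr F L ≃+* UCP (groupRingBasis G) (groupRingBasis G), e 1 = 1 := by
  set a := groupRingBasis G
  let φ : UCPIndex a a ≃ Irr F L := Equiv.ofBijective (classOfIndex w hw)
    ⟨classOfIndex_injective hw hinj, classOfIndex_surjective hw hL hsurj⟩
  let f : UCP a a ≃+ Gr F L := (Finsupp.domCongr φ : (UCPIndex a a →₀ ℤ) ≃+ (Irr F L →₀ ℤ))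
  have hf : ∀ x, f (UCP.of x) = Gr.of (classOfIndex w hw x) := fun x =>
    Finsupp.equivMapDomain_single φ x 1
  have hw0 : w a.one = 0 := map_zero w
  have hw1 : ∀ {g : G}, g ≠ a.one → w g ≠ 0 := fun hg h => hg (hinj (h.trans hw0.symm))
  -- The case of the unit is needed as well: two non-zero group elements may have sum zero.
  have hl : ∀ g, f (UCP.inl a a (a.basis g)) = Gr.of (Irr.sym (w g) (hw g)) := by
    intro g
    by_cases hg : g = a.one
    · rw [Irr.sym_zero (hw g) (hg ▸ hw0), hg, UCP.inl_basis_one, hf]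
      rfl
    · rw [UCP.inl_basis a a hg, hf]
      rfl
  have hr : ∀ g, f (UCP.inr a a (a.basis g)) = Gr.of (Irr.anti (w g) (hw g)) := by
    intro g
    by_cases hg : g = a.one
    · rw [Irr.anti_zero (hw g) (hg ▸ hw0), hg, UCP.inr_basis_one, hf]
      rfl
    · rw [UCP.inr_basis a a hg, hf]
      rfl
  have hmul : ∀ x y : UCPIndex a a, f (UCP.basisMul a a x y) = f (UCP.of x) * f (UCP.of y) := by
    intro x y
    rw [hf, hf]
    rcases x with _ | ⟨i, hi⟩ | ⟨i, hi⟩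
    · rw [UCP.basisMul_none, hf]
      exact (Gr.triv_mul hL _).symm
    all_goals rcases y with _ | ⟨j, hj⟩ | ⟨j, hj⟩
    · exact (hf _).trans (Gr.mul_triv hL _).symm
    · change f (UCP.inl a a (a.basis i * a.basis j)) = _
      rw [groupRingBasis_mul, hl]
      have := Gr.sym_mul_sym (hw i) (hw j) (by rw [← map_add]; exact hw _)
      simp only [map_add]
      exact this.symm
    · exact (map_zero f).trans (Gr.sym_mul_anti (hw i) (hw j) (hw1 hi) (hw1 hj)).symm
    · exact (hf _).trans (Gr.mul_triv hL _).symm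
    · exact (map_zero f).trans (Gr.anti_mul_sym (hw i) (hw j) (hw1 hi) (hw1 hj)).symm
    · change f (UCP.inr a a (a.basis i * a.basis j)) = _
      rw [groupRingBasis_mul, hr]
      have := Gr.anti_mul_anti (hw i) (hw j) (by rw [← map_add]; exact hw _)
      simp only [map_add]
      exact this.symm
  have hmul' : ∀ s t, f (s * t) = f s * f t := by
    -- Multiplicativity is an equality of biadditive maps, so it may be checked on basis elements.
    have : (UCP.mulHom a a).compr₂ f.toAddMonoidHom =
        (AddMonoidHom.mul.compl₂ f.toAddMonoidHom).comp f.toAddMonoidHom := by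
      refine UCP.addHom_ext a a fun x => UCP.addHom_ext a a fun y => ?_
      exact (congrArg f (UCP.mulHom_of a a x y)).trans (hmul x y)
    exact fun s t => DFunLike.congr_fun (DFunLike.congr_fun this s) t
  let e : UCP a a ≃+* Gr F L := { f with map_mul' := hmul' }
  refine ⟨e.symm, (RingEquiv.symm_apply_eq e).2 ?_⟩
  exact (hf none).symm

end Isomorphism

end LeibnizAlg

theorem corollary4p8 {F : Type u} {L : Type v} [Field F] [IsAlgClosed F] [CharZero F]
    [NonUnitalNonAssocRing L] [Module F L] [IsScalarTower F L L] [SMulCommClass F L L]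
    [IsLeftLeibniz L] (hsolv : LeibnizAlg.IsSolvable F L)
    (hfin : FiniteDimensional F (LeibnizAlg.LLie F L)) :
    ∃ e : LeibnizAlg.Gr F L ≃+*
        LeibnizAlg.UCP
          (LeibnizAlg.groupRingBasis (Fin (LeibnizAlg.abelianRank F L) → F))
          (LeibnizAlg.groupRingBasis (Fin (LeibnizAlg.abelianRank F L) → F)),
      e 1 = 1 := by
  obtain ⟨w, hinj, hw⟩ := LeibnizAlg.exists_weights F L
  -- Only the additive structure of `F ^ k` enters the group ring, so the linearity of `w` is
  -- dropped.
  exact LeibnizAlg.exists_ringEquiv (w := w.toAddMonoidHom) (fun g => (hw (w g)).1 ⟨g, rfl⟩) hsolv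
    hinj fun σ hσ => (hw σ).2 hσ
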